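/- A figure is a finite subset $F\subset\mathbb{Z}^2$; a pattern $\mathcal{P}$ is the set of all integer translates of a figure. The pattern is convex if every figure $F\in\mathcal{P}$ satisfies $F=\operatorname{conv}_{\mathbb{R}^2}(F)\cap\mathbb{Z}^2$. For a finite alphabet $A$ and a word $w:\mathbb{Z}^2\to A$, the abelian pattern complexity $a_w(\mathcal{P})$ is the number of distinct functions $a\mapsto \#\{x\in F: w(x)=a\}$ on $A$, where $F$ ranges over $\mathcal{P}$. The word $w$ is fully periodic if there are two linearly independent vectors $u,v\in\mathbb{Z}^2$ with $w(x+u)=w(x+v)=w(x)$ for all $x$. The pattern $\mathcal{P}$ is abelian rigid if every word $w$ over a finite alphabet with $a_w(\mathcal{P})=1$ is fully periodic. The polynomial of a figure $F$ is $\sum_{(i,j)\in F}x^iy^j\in\mathbb{Z}[x^{\pm1},y^{\pm1}]$; for figures of the same pattern these differ only by monomial factors. A non-trivial strongly linear polynomial is a Laurent polynomial $\sum_{i=0}^{l}x^{iv_1}y^{iv_2}$ with $(v_1,v_2)\in\mathbb{Z}^2\setminus\{0\}$ and $l\ge 1$. The pattern $\mathcal{P}$ is relatively prime if for each $F\in\mathcal{P}$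 and every non-zero $u\in\mathbb{Z}^2$ the numbers $\#(F\cap L)$, where $L$ ranges over the lines parallel to $u$ that meet $F$, have greatest common divisor $1$ (the gcd of the empty family being $0$). **Theorem.** Let $\mathcal{P}$ be a convex pattern in $\mathbb{Z}^2$. 1. For every figure $F\in\mathcal{P}$, the polynomial of $F$ is divisible in $\mathbb{Z}[x^{\pm1},y^{\pm1}]$ by a non-trivial strongly linear polynomial if and only if $\mathcal{P}$ is not abelian rigid. 2. $\mathcal{P}$ is abelian rigid if and only if it is relatively prime. -/

import Mathlib

noncomputable section

/-- A figure of `ℤ²`: a finite set of lattice points. -/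
abbrev Figure := Finset (ℤ × ℤ)

/-- The translate `F + t` of a figure. -/
def Figure.translate (F : Figure) (t : ℤ × ℤ) : Figure := F.image (fun p => p + t)

/-- A pattern: an equivalence class of figures under translation,
i.e. the set of all integer translates of some figure. -/
def IsPattern (P : Set Figure) : Prop :=
  ∃ F : Figure, P = {G | ∃ t : ℤ × ℤ, G = F.translate t}

/-- The inclusion of `ℤ²` in `ℝ²`. -/
def latticeToPlane (p : ℤ × ℤ) : ℝ × ℝ := ((p.1 : ℝ), (p.2 : ℝ))

/-- A figure is convex if it consists of all the lattice points of its convex hull in `ℝ²`. -/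
def Figure.IsConvex (F : Figure) : Prop :=
  (F : Set (ℤ × ℤ)) =
    {p | latticeToPlane p ∈ convexHull ℝ (latticeToPlane '' (F : Set (ℤ × ℤ)))}

/-- A pattern is convex if all its figures are convex. -/
def IsConvexPattern (P : Set Figure) : Prop := ∀ F ∈ P, F.IsConvex

/-- A two-dimensional word is fully periodic if it has two linearly independent periods. -/
def IsFullyPeriodic {A : Type*} (w : ℤ × ℤ → A) : Prop :=
  ∃ u v : ℤ × ℤ, LinearIndependent ℤ ![u, v] ∧ (∀ x, w (x + u) = w x) ∧ (∀ x, w (x + v) = w x)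

open Classical in
/-- The number of occurrences of the letter `a` in the restriction of the word `w` to `F`. -/
def letterCount {A : Type*} (w : ℤ × ℤ → A) (F : Figure) (a : A) : ℕ :=
  (F.filter (fun p => w p = a)).card

/-- The abelian pattern complexity: the number of abelian equivalence classes of the factors
`w|_F`, `F ∈ P`. Two factors are abelian equivalent iff all their letter counts agree, so the
classes correspond to the distinct functions `letterCount w F`. -/
def abelianComplexity {A : Type*} (w : ℤ × ℤ → A) (P : Set Figure) : ℕ∞ :=
  ((fun F => letterCount w F) '' P).encard

/-- A pattern is abelian rigid if only fully periodic words (over finite alphabets) have abelian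
complexity `1` over it. -/
def IsAbelianRigid (P : Set Figure) : Prop :=
  ∀ (A : Type) [Finite A] (w : ℤ × ℤ → A), abelianComplexity w P = 1 → IsFullyPeriodic w

/-- Integer Laurent polynomials in two variables, `ℤ[x, x⁻¹, y, y⁻¹]`;
`single (i, j) c` is the term `c xⁱ yʲ`. -/
abbrev Laurent2 := AddMonoidAlgebra ℤ (ℤ × ℤ)

/-- The polynomial `∑_{(i, j) ∈ F} xⁱ yʲ` of a figure. -/
def Figure.poly (F : Figure) : Laurent2 := ∑ p ∈ F, AddMonoidAlgebra.single p (1 : ℤ)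

/-- The strongly linear polynomial `∑_{i = 0}^{l} x^{i v₁} y^{i v₂}`. -/
def stronglyLinear (v : ℤ × ℤ) (l : ℕ) : Laurent2 :=
  ∑ i ∈ Finset.range (l + 1), AddMonoidAlgebra.single (i • v) (1 : ℤ)

/-- Having a non-trivial (that is, with `v ≠ 0` and `l ≥ 1`) strongly linear divisor. -/
def HasStronglyLinearDivisor (f : Laurent2) : Prop :=
  ∃ (v : ℤ × ℤ) (l : ℕ), v ≠ 0 ∧ 1 ≤ l ∧ stronglyLinear v l ∣ f

/-- The number of points of `F` on the line through `p` parallel to `u`. -/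
def Figure.lineLength (F : Figure) (u p : ℤ × ℤ) : ℕ :=
  (F.filter (fun q => u.1 * (q.2 - p.2) = u.2 * (q.1 - p.1))).card

/-- `u`-relative primality: the lengths of the intersections of `F` with the lines parallel to `u`
that meet `F` have greatest common divisor `1`. (The gcd of the empty family is `0`.) -/
def Figure.IsRelativelyPrimeAlong (F : Figure) (u : ℤ × ℤ) : Prop :=
  F.gcd (fun p => F.lineLength u p) = 1

/-- A pattern is relatively prime if it is `u`-relatively prime for every direction `u`. -/
def IsRelativelyPrimePattern (P : Set Figure) : Prop :=
  ∀ u : ℤ × ℤ, u ≠ 0 → ∀ F ∈ P, F.IsRelativelyPrimeAlong u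

end

/-! Everything reduces to one cycle: a strongly linear divisor excludes rigidity, relative primality
gives rigidity, and failure of relative primality gives a strongly linear divisor.

The last implication is where lines meet algebra: in a convex figure the points on a line form a run
of consecutive lattice points, so a common divisor of all run lengths cuts every run into equal
blocks (`stronglyLinear_dvd_poly`). For the first, color each line parallel to `v` periodically with
period `l + 1` and shift the phase on a single line: sums over blocks stay constant, but full
periodicity is lost.

The hard implication (`hasFullPeriod_of_sum_const`) treats the indicator `c` of a letter, whose sums
over `F` are constant. By Frobenius modulo large primes the sums over the dilates `(1 + |F|! j) F`
have the same constant value. Averaging over `j` writes `c` as a constant minus bounded functions `φ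
p`, each periodic along `p` (`exists_periodic_decomposition`). Group the `φ p` by direction.
Difference operators killing the other directions turn one group into a function with finitely many
values and constant sums over `F`. Its Fourier components along `u` satisfy recurrences across the
lines, with geometric sums of roots of unity as coefficients; relative primality prevents all of
these from vanishing, so the components are fully periodic. Boundedness then lets the differences be
undone. -/

/-! ### The action of Laurent polynomials on configurations -/

section Action

variable {R : Type*} [CommRing R]

/-- Translation of configurations, as a monoid homomorphism into linear endomorphisms. -/
def shiftHom (R : Type*) [CommRing R] :
    Multiplicative (ℤ × ℤ) →* Module.End R (ℤ × ℤ → R) where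
  toFun v := LinearMap.funLeft R R (fun x => x + v.toAdd)
  map_one' := by ext; simp [LinearMap.funLeft]
  map_mul' u v := by
    apply LinearMap.ext
    intro ψ
    funext x
    simp [LinearMap.funLeft, add_comm, add_left_comm]

/-- Laurent polynomials act on configurations: `xⁱ yʲ` shifts by `(i, j)`. -/
noncomputable def convAct (R : Type*) [CommRing R] :
    AddMonoidAlgebra R (ℤ × ℤ) →ₐ[R] Module.End R (ℤ × ℤ → R) :=
  AddMonoidAlgebra.lift R _ _ (shiftHom R)

theorem convAct_single (v : ℤ × ℤ) (r : R) (ψ : ℤ × ℤ → R) (x : ℤ × ℤ) :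
    convAct R (AddMonoidAlgebra.single v r) ψ x = r * ψ (x + v) := by
  rw [convAct, AddMonoidAlgebra.lift_single]
  simp [shiftHom, LinearMap.funLeft]

theorem convAct_sum_single {ι : Type*} (s : Finset ι) (p : ι → ℤ × ℤ) (ψ : ℤ × ℤ → R)
    (x : ℤ × ℤ) :
    convAct R (∑ i ∈ s, AddMonoidAlgebra.single (p i) 1) ψ x = ∑ i ∈ s, ψ (x + p i) := by
  rw [map_sum, LinearMap.sum_apply, Finset.sum_apply]
  simp [convAct_single]

theorem convAct_single_sub_one (v : ℤ × ℤ) (ψ : ℤ × ℤ → R) (x : ℤ × ℤ) :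
    convAct R (AddMonoidAlgebra.single v 1 - 1) ψ x = ψ (x + v) - ψ x := by
  rw [map_sub, map_one]
  simp [convAct_single]

theorem convAct_mul (f g : AddMonoidAlgebra R (ℤ × ℤ)) (ψ : ℤ × ℤ → R) :
    convAct R (f * g) ψ = convAct R f (convAct R g ψ) := by
  rw [map_mul]; rfl

theorem convAct_comm (f g : AddMonoidAlgebra R (ℤ × ℤ)) (ψ : ℤ × ℤ → R) :
    convAct R f (convAct R g ψ) = convAct R g (convAct R f ψ) := by
  rw [← convAct_mul, ← convAct_mul, mul_comm]

theorem convAct_const (f : AddMonoidAlgebra R (ℤ × ℤ)) (k : R) :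
    ∃ k', convAct R f (fun _ => k) = fun _ => k' := by
  induction f using AddMonoidAlgebra.induction_on with
  | of v =>
    exact ⟨k, funext fun x => by simp [AddMonoidAlgebra.of_apply, convAct_single]⟩
  | add f g hf hg =>
    obtain ⟨a, ha⟩ := hf
    obtain ⟨b, hb⟩ := hg
    exact ⟨a + b, by rw [map_add, LinearMap.add_apply, ha, hb]; rfl⟩
  | smul r f hf =>
    obtain ⟨a, ha⟩ := hf
    exact ⟨r * a, by rw [map_smul, LinearMap.smul_apply, ha]; rfl⟩

theorem convAct_shift (f : AddMonoidAlgebra R (ℤ × ℤ)) (ψ : ℤ × ℤ → R) {v : ℤ × ℤ}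
    (h : ∀ x, ψ (x + v) = ψ x) (x : ℤ × ℤ) : convAct R f ψ (x + v) = convAct R f ψ x := by
  have h1 : convAct R (AddMonoidAlgebra.single v 1) ψ = ψ := by
    funext x; rw [convAct_single, one_mul, h]
  have h2 := congrFun (convAct_comm (AddMonoidAlgebra.single v 1) f ψ) x
  rwa [convAct_single, one_mul, h1] at h2

theorem convAct_finite_range (f : AddMonoidAlgebra R (ℤ × ℤ)) (ψ : ℤ × ℤ → R)
    (h : (Set.range ψ).Finite) : (Set.range (convAct R f ψ)).Finite := by
  induction f using AddMonoidAlgebra.induction_on with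
  | of v =>
    refine h.subset ?_
    rintro _ ⟨x, rfl⟩
    exact ⟨x + v, by simp [AddMonoidAlgebra.of_apply, convAct_single]⟩
  | add f g hf hg =>
    refine (Set.Finite.image2 (· + ·) hf hg).subset ?_
    rintro _ ⟨x, rfl⟩
    exact ⟨_, ⟨x, rfl⟩, _, ⟨x, rfl⟩, by simp⟩
  | smul r f hf =>
    refine (hf.image (r * ·)).subset ?_
    rintro _ ⟨x, rfl⟩
    exact ⟨_, ⟨x, rfl⟩, by simp⟩

end Action

theorem convAct_bounded (f : AddMonoidAlgebra ℂ (ℤ × ℤ)) (ψ : ℤ × ℤ → ℂ)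
    (h : ∃ B, ∀ x, ‖ψ x‖ ≤ B) : ∃ B, ∀ x, ‖convAct ℂ f ψ x‖ ≤ B := by
  obtain ⟨B, hB⟩ := h
  induction f using AddMonoidAlgebra.induction_on with
  | of v =>
    exact ⟨B, fun x => by simpa [AddMonoidAlgebra.of_apply, convAct_single] using hB _⟩
  | add f g hf hg =>
    obtain ⟨a, ha⟩ := hf
    obtain ⟨b, hb⟩ := hg
    refine ⟨a + b, fun x => ?_⟩
    rw [map_add, LinearMap.add_apply]
    exact (norm_add_le _ _).trans (add_le_add (ha x) (hb x))
  | smul r f hf =>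
    obtain ⟨a, ha⟩ := hf
    refine ⟨‖r‖ * a, fun x => ?_⟩
    rw [map_smul, LinearMap.smul_apply, Pi.smul_apply, norm_smul]
    exact mul_le_mul_of_nonneg_left (ha x) (norm_nonneg _)

/-! ### Dilations of a figure with constant sums -/

/-- In characteristic `q` the `q`-th power of the polynomial of `nF` is that of `qnF`. Applying it
to `c` gives `|F| ^ (q - 1) * k`, which is `k` by Fermat. -/
theorem sum_dilate_prime (F : Figure) (hF : F.Nonempty) (c : ℤ × ℤ → ℤ)
    (hc : ∀ x, c x = 0 ∨ c x = 1) (k : ℤ) (n q : ℕ) (hq : q.Prime) (hqF : F.card < q)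
    (h : ∀ x, ∑ p ∈ F, c (x + n • p) = k) (x : ℤ × ℤ) :
    ∑ p ∈ F, c (x + (q * n) • p) = k := by
  have : Fact q.Prime := ⟨hq⟩
  have hbd : ∀ (m : ℕ) (y : ℤ × ℤ), 0 ≤ ∑ p ∈ F, c (y + m • p) ∧
      ∑ p ∈ F, c (y + m • p) ≤ F.card := by
    intro m y
    constructor
    · exact Finset.sum_nonneg fun p _ => by rcases hc (y + m • p) with h | h <;> rw [h] <;> norm_num
    · refine (Finset.sum_le_sum (g := fun _ => (1 : ℤ)) fun p _ => ?_).trans (by simp)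
      rcases hc (y + m • p) with h | h <;> rw [h] <;> norm_num
  let f : AddMonoidAlgebra (ZMod q) (ℤ × ℤ) := ∑ p ∈ F, AddMonoidAlgebra.single (n • p) 1
  have hfq : f ^ q = ∑ p ∈ F, AddMonoidAlgebra.single ((q * n) • p) 1 := by
    have : CharP (AddMonoidAlgebra (ZMod q) (ℤ × ℤ)) q :=
      charP_of_injective_algebraMap (R := ZMod q) (FaithfulSMul.algebraMap_injective _ _) q
    simp only [f]
    rw [sum_pow_char q]
    simp [AddMonoidAlgebra.single_pow, mul_smul]
  let c' : ℤ × ℤ → ZMod q := fun y => (c y : ZMod q)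
  have hf1 : convAct (ZMod q) f c' = fun _ => (k : ZMod q) := by
    funext y
    rw [convAct_sum_single, ← h y]
    push_cast
    rfl
  have hfk : ∀ m : ℕ, convAct (ZMod q) (f ^ (m + 1)) c' =
      fun _ => (F.card : ZMod q) ^ m * (k : ZMod q) := by
    intro m
    induction m with
    | zero => simpa using hf1
    | succ m ih =>
      rw [pow_succ', convAct_mul, ih]
      funext y
      rw [convAct_sum_single, Finset.sum_const, nsmul_eq_mul]
      ring
  have hcard : (F.card : ZMod q) ≠ 0 := by
    rw [Ne, ZMod.natCast_eq_zero_iff]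
    exact Nat.not_dvd_of_pos_of_lt hF.card_pos hqF
  have h2 := congrFun (hfk (q - 1)) x
  rw [Nat.sub_add_cancel hq.one_lt.le, hfq, convAct_sum_single,
    ZMod.pow_card_sub_one_eq_one hcard, one_mul] at h2
  have h3 : ((∑ p ∈ F, c (x + (q * n) • p) : ℤ) : ZMod q) = ((k : ℤ) : ZMod q) := by
    push_cast
    exact h2
  rw [ZMod.intCast_eq_intCast_iff_dvd_sub] at h3
  have hk := hbd n 0
  rw [h 0] at hk
  have h4 := hbd (q * n) x
  -- Both sums lie in `[0, |F|]` and `|F| < q`, so the congruence is an equality.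
  have := Int.eq_zero_of_abs_lt_dvd h3 (by rw [abs_lt]; constructor <;> omega)
  omega

theorem sum_dilate (F : Figure) (hF : F.Nonempty) (c : ℤ × ℤ → ℤ)
    (hc : ∀ x, c x = 0 ∨ c x = 1) (k : ℤ) (h : ∀ x, ∑ p ∈ F, c (x + p) = k) (n : ℕ)
    (hn0 : n ≠ 0) (hn : ∀ q : ℕ, q.Prime → q ∣ n → F.card < q) (x : ℤ × ℤ) :
    ∑ p ∈ F, c (x + n • p) = k := by
  induction n using induction_on_primes generalizing x with
  | zero => exact absurd rfl hn0
  | one => simpa using h x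
  | prime_mul q a hq ih =>
    refine sum_dilate_prime F hF c hc k a q hq (hn q hq (dvd_mul_right _ _)) ?_ x
    exact ih (fun h0 => hn0 (by simp [h0])) fun q' hq' hd => hn q' hq' (hd.mul_left _)

theorem sum_dilate_factorial (F : Figure) (hF : F.Nonempty) (c : ℤ × ℤ → ℤ)
    (hc : ∀ x, c x = 0 ∨ c x = 1) (k : ℤ) (h : ∀ x, ∑ p ∈ F, c (x + p) = k) (j : ℕ)
    (x : ℤ × ℤ) : ∑ p ∈ F, c (x + (1 + F.card.factorial * j) • p) = k := by
  refine sum_dilate F hF c hc k h _ (by omega) (fun q hq hd => ?_) x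
  by_contra hle
  have h1 : q ∣ F.card.factorial := (Nat.Prime.dvd_factorial hq).2 (not_lt.1 hle)
  have h2 := (Nat.dvd_add_left (h1.mul_right j)).1 hd
  exact hq.one_lt.ne' (Nat.dvd_one.1 h2)

/-! ### Full periodicity -/

/-- Some positive multiple of every lattice vector is a period. -/
def HasFullPeriod {α : Type*} (ψ : ℤ × ℤ → α) : Prop :=
  ∃ N : ℕ, 0 < N ∧ ∀ v x, ψ (x + N • v) = ψ x

/-- Some positive multiple of `u` is a period. -/
def HasPeriodAlong {α : Type*} (u : ℤ × ℤ) (ψ : ℤ × ℤ → α) : Prop :=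
  ∃ N : ℕ, 0 < N ∧ ∀ x, ψ (x + N • u) = ψ x

/-- The determinant of two lattice vectors. -/
def cross (u p : ℤ × ℤ) : ℤ := u.1 * p.2 - u.2 * p.1

theorem cross_add (u p q : ℤ × ℤ) : cross u (p + q) = cross u p + cross u q := by
  simp only [cross, Prod.fst_add, Prod.snd_add]; ring

theorem cross_smul (u p : ℤ × ℤ) (n : ℤ) : cross u (n • p) = n * cross u p := by
  simp only [cross, Prod.smul_fst, Prod.smul_snd, smul_eq_mul]; ring

theorem smul_cross (u p : ℤ × ℤ) (n : ℤ) : cross (n • u) p = n * cross u p := by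
  simp only [cross, Prod.smul_fst, Prod.smul_snd, smul_eq_mul]; ring

theorem period_nsmul {α : Type*} {ψ : ℤ × ℤ → α} {v : ℤ × ℤ} (h : ∀ x, ψ (x + v) = ψ x)
    (n : ℕ) (x : ℤ × ℤ) : ψ (x + n • v) = ψ x := by
  induction n generalizing x with
  | zero => simp
  | succ n ih => rw [succ_nsmul, ← add_assoc, h, ih]

theorem period_zsmul {α : Type*} {ψ : ℤ × ℤ → α} {v : ℤ × ℤ} (h : ∀ x, ψ (x + v) = ψ x)
    (n : ℤ) (x : ℤ × ℤ) : ψ (x + n • v) = ψ x := by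
  obtain ⟨m, rfl | rfl⟩ := n.eq_nat_or_neg
  · rw [natCast_zsmul]; exact period_nsmul h m x
  · have := period_nsmul h m (x + (-(m : ℤ)) • v)
    rw [← this, neg_smul, natCast_zsmul, neg_add_cancel_right]

theorem hasFullPeriod_of_cross {α : Type*} {ψ : ℤ × ℤ → α} {u v : ℤ × ℤ}
    (huv : cross u v ≠ 0) (hu : ∀ x, ψ (x + u) = ψ x) (hv : ∀ x, ψ (x + v) = ψ x) :
    HasFullPeriod ψ := by
  refine ⟨(cross u v).natAbs, Int.natAbs_pos.2 huv, fun w x => ?_⟩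
  have key : ∀ x, ψ (x + (cross u v) • w) = ψ x := by
    intro x
    -- Cramer's rule with the denominator cleared.
    have : (cross u v) • w = (cross w v) • u + (cross u w) • v := by
      ext <;> simp [cross] <;> ring
    rw [this, ← add_assoc, period_zsmul hv, period_zsmul hu]
  rw [← natCast_zsmul]
  rcases Int.natAbs_eq (cross u v) with h | h
  · rw [← h]; exact key x
  · have h' : ((cross u v).natAbs : ℤ) = (-1) * cross u v := by omega
    rw [h', mul_smul]
    exact period_zsmul key (-1) x

theorem HasFullPeriod.isFullyPeriodic {α : Type*} {ψ : ℤ × ℤ → α} (h : HasFullPeriod ψ) :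
    IsFullyPeriodic ψ := by
  obtain ⟨N, hN, h⟩ := h
  refine ⟨N • (1, 0), N • (0, 1), ?_, h _, h _⟩
  rw [LinearIndependent.pair_iff]
  intro s t hst
  simpa [hN.ne'] using hst

theorem IsFullyPeriodic.hasFullPeriod {α : Type*} {ψ : ℤ × ℤ → α} (h : IsFullyPeriodic ψ) :
    HasFullPeriod ψ := by
  obtain ⟨u, v, hli, hu, hv⟩ := h
  refine hasFullPeriod_of_cross (fun h0 => ?_) hu hv
  rw [LinearIndependent.pair_iff] at hli
  have h1 := hli v.2 (-u.2) (by
    ext <;> simp [cross] at h0 ⊢ <;> linarith)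
  have h2 := hli v.1 (-u.1) (by
    ext <;> simp [cross] at h0 ⊢ <;> linarith)
  have h3 := hli 1 0 (by ext <;> simp <;> omega)
  exact one_ne_zero h3.1

theorem HasPeriodAlong.sum {ι M : Type*} [AddCommMonoid M] {u : ℤ × ℤ} (s : Finset ι)
    (ψ : ι → ℤ × ℤ → M) (h : ∀ i ∈ s, HasPeriodAlong u (ψ i)) :
    HasPeriodAlong u (fun x => ∑ i ∈ s, ψ i x) := by
  classical
  choose! N hN hψ using h
  refine ⟨∏ i ∈ s, N i, Finset.prod_pos hN, fun x => Finset.sum_congr rfl fun i hi => ?_⟩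
  rw [← Finset.mul_prod_erase s N hi, mul_comm, mul_smul]
  exact period_nsmul (hψ i hi) _ x

theorem HasFullPeriod.common {ι : Type*} (s : Finset ι) {α : Type*}
    (ψ : ι → ℤ × ℤ → α) (h : ∀ i ∈ s, HasFullPeriod (ψ i)) :
    ∃ N : ℕ, 0 < N ∧ ∀ i ∈ s, ∀ v x, ψ i (x + N • v) = ψ i x := by
  classical
  choose! N hN hψ using h
  refine ⟨∏ i ∈ s, N i, Finset.prod_pos hN, fun i hi v x => ?_⟩
  rw [← Finset.mul_prod_erase s N hi, mul_smul]
  exact hψ i hi _ x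

theorem HasFullPeriod.sum {ι M : Type*} [AddCommMonoid M] (s : Finset ι)
    (ψ : ι → ℤ × ℤ → M) (h : ∀ i ∈ s, HasFullPeriod (ψ i)) :
    HasFullPeriod (fun x => ∑ i ∈ s, ψ i x) := by
  obtain ⟨N, hN, hψ⟩ := HasFullPeriod.common s ψ h
  exact ⟨N, hN, fun v x => Finset.sum_congr rfl fun i hi => hψ i hi v x⟩

theorem HasFullPeriod.comp {α β : Type*} {ψ : ℤ × ℤ → α} (h : HasFullPeriod ψ) (g : α → β) :
    HasFullPeriod (fun x => g (ψ x)) := by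
  obtain ⟨N, hN, h⟩ := h
  exact ⟨N, hN, fun v x => by simp only [h v x]⟩

/-! ### Bounded configurations with fully periodic differences -/

theorem eq_zero_of_bounded_arithmetic {s : ℕ → ℂ} {d : ℂ} (hs : ∀ n, s (n + 1) = s n + d)
    (hb : ∃ B, ∀ n, ‖s n‖ ≤ B) : d = 0 := by
  obtain ⟨B, hB⟩ := hb
  have h1 : ∀ n : ℕ, s n = s 0 + n * d := by
    intro n
    induction n with
    | zero => simp
    | succ n ih => rw [hs, ih]; push_cast; ring
  by_contra hd
  have hd' : 0 < ‖d‖ := norm_pos_iff.2 hd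
  obtain ⟨n, hn⟩ := exists_nat_gt (2 * B / ‖d‖)
  rw [div_lt_iff₀ hd'] at hn
  have h2 : ‖(n : ℂ) * d‖ ≤ B + B := by
    have : (n : ℂ) * d = s n - s 0 := by rw [h1 n]; ring
    rw [this]
    exact (norm_sub_le _ _).trans (add_le_add (hB n) (hB 0))
  rw [norm_mul, Complex.norm_natCast] at h2
  linarith

/-- If the difference along `w` has period `N • w`, then `ψ` runs through an arithmetic progression
along steps of `N • w`. Boundedness forces the increment to be zero, which supplies a second period
independent of `v`. -/
theorem hasFullPeriod_of_difference {ψ : ℤ × ℤ → ℂ} (hb : ∃ B, ∀ x, ‖ψ x‖ ≤ B)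
    {v w : ℤ × ℤ} (hv : ∀ x, ψ (x + v) = ψ x) (hvw : cross v w ≠ 0)
    (h : HasFullPeriod (convAct ℂ (AddMonoidAlgebra.single w 1 - 1) ψ)) : HasFullPeriod ψ := by
  obtain ⟨N, hN, h⟩ := h
  obtain ⟨B, hB⟩ := hb
  simp only [convAct_single_sub_one] at h
  have hmul : ∀ (n : ℕ) x, ψ (x + N • w + n • w) - ψ (x + N • w) = ψ (x + n • w) - ψ x := by
    intro n
    induction n with
    | zero => intro x; simp
    | succ n ih =>
      intro x
      have h1 := h w (x + n • w)
      have h2 := ih x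
      have e1 : x + N • w + (n + 1) • w = x + n • w + N • w + w := by
        rw [succ_nsmul]; abel
      have e2 : x + N • w + n • w = x + n • w + N • w := by abel
      have e3 : x + (n + 1) • w = x + n • w + w := by rw [succ_nsmul]; abel
      rw [e1, e3]
      rw [e2] at h2
      linear_combination h1 + h2
  have hw : ∀ x, ψ (x + N • w) = ψ x := by
    intro x
    have := eq_zero_of_bounded_arithmetic (s := fun n => ψ (x + n • (N • w)))
      (d := ψ (x + N • w) - ψ x) (fun n => ?_) ⟨B, fun n => hB _⟩
    · exact sub_eq_zero.1 this
    · induction n with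
      | zero => simp
      | succ n ih =>
        have h3 := hmul N (x + n • (N • w))
        have e1 : x + (n + 1 + 1) • (N • w) = x + n • (N • w) + N • w + N • w := by
          rw [succ_nsmul, succ_nsmul]; abel
        have e2 : x + (n + 1) • (N • w) = x + n • (N • w) + N • w := by
          rw [succ_nsmul]; abel
        simp only [e1, e2] at ih ⊢
        linear_combination h3 + ih
  refine hasFullPeriod_of_cross ?_ hv hw
  rw [← natCast_zsmul, cross_smul]
  exact mul_ne_zero (by exact_mod_cast hN.ne') hvw

theorem hasFullPeriod_of_prod_difference {ψ : ℤ × ℤ → ℂ} (hb : ∃ B, ∀ x, ‖ψ x‖ ≤ B)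
    {v : ℤ × ℤ} (hv : ∀ x, ψ (x + v) = ψ x) {ι : Type*} (s : Finset ι) (w : ι → ℤ × ℤ)
    (hw : ∀ i ∈ s, cross v (w i) ≠ 0)
    (h : HasFullPeriod (convAct ℂ (∏ i ∈ s, (AddMonoidAlgebra.single (w i) 1 - 1)) ψ)) :
    HasFullPeriod ψ := by
  classical
  induction s using Finset.induction_on with
  | empty => simpa using h
  | insert i s hi ih =>
    refine ih (fun j hj => hw j (Finset.mem_insert_of_mem hj)) ?_
    rw [Finset.prod_insert hi, convAct_mul] at h
    exact hasFullPeriod_of_difference (convAct_bounded _ _ hb) (convAct_shift _ _ hv)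
      (hw i (Finset.mem_insert_self _ _)) h

/-! ### Linear recurrences with finitely many values -/

theorem recurrence_eq_zero_forward {d r : ℤ → ℂ} {J : Finset ℤ} {a b : ℤ} (hb : b ∈ J)
    (hJ : ∀ j ∈ J, a ≤ j ∧ j ≤ b) (hrb : r b ≠ 0) (h : ∀ n, ∑ j ∈ J, r j * d (n + j) = 0)
    {m : ℤ} (hm : ∀ n, m ≤ n → n < m + (b - a) → d n = 0) (n : ℤ) (hn : m ≤ n) : d n = 0 := by
  have key : ∀ k : ℕ, d (m + k) = 0 := by
    intro k
    induction k using Nat.strong_induction_on with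
    | _ k ih =>
      by_cases hk : (k : ℤ) < b - a
      · exact hm _ (by omega) (by omega)
      · have h1 := h (m + k - b)
        rw [Finset.sum_eq_single b, sub_add_cancel] at h1
        · exact (mul_eq_zero.1 h1).resolve_left hrb
        · intro j hj hjb
          have hj' := hJ j hj
          have h2 := ih (k - b + j).toNat (by omega)
          rw [show m + ((k - b + j).toNat : ℤ) = m + k - b + j by omega] at h2
          rw [h2, mul_zero]
        · exact fun hb' => absurd hb hb'
  have := key (n - m).toNat
  rwa [show m + ((n - m).toNat : ℤ) = n by omega] at this

theorem recurrence_eq_zero {d r : ℤ → ℂ} {J : Finset ℤ} {a b : ℤ} (ha : a ∈ J) (hb : b ∈ J)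
    (hJ : ∀ j ∈ J, a ≤ j ∧ j ≤ b) (hra : r a ≠ 0) (hrb : r b ≠ 0)
    (h : ∀ n, ∑ j ∈ J, r j * d (n + j) = 0)
    {m : ℤ} (hm : ∀ n, m ≤ n → n < m + (b - a) → d n = 0) (n : ℤ) : d n = 0 := by
  rcases le_total m n with hn | hn
  · exact recurrence_eq_zero_forward hb hJ hrb h hm n hn
  -- Reflecting `n ↦ -n` exchanges the two extreme coefficients; the zero window now starts at `-(m
  -- + (b - a)) + 1`.
  · have := recurrence_eq_zero_forward (d := fun n => d (-n)) (r := fun n => r (-n))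
      (J := J.image (fun j => -j)) (a := -b) (b := -a) (m := -(m + (b - a)) + 1)
      (Finset.mem_image_of_mem _ ha) ?_ (by simpa using hra) ?_ ?_ (-n)
    · have hab := (hJ a ha).2
      by_cases hn' : n < m + (b - a)
      · simpa using this (by omega)
      · exact recurrence_eq_zero_forward hb hJ hrb h hm n (by omega)
    · intro j hj
      obtain ⟨i, hi, rfl⟩ := Finset.mem_image.1 hj
      have := hJ i hi
      omega
    · intro k
      rw [Finset.sum_image (by intro x _ y _ hxy; simpa using hxy), ← h (-k)]
      refine Finset.sum_congr rfl fun j _ => ?_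
      simp only [neg_neg, neg_add]
    · intro k h1 h2
      exact hm _ (by omega) (by omega)

/-- By pigeonhole two windows of length `b - a` coincide. The difference of the corresponding shifts
of `s` satisfies the homogeneous recurrence and vanishes on a window, hence everywhere. -/
theorem exists_period_of_recurrence {s r : ℤ → ℂ} (hs : (Set.range s).Finite) {J : Finset ℤ}
    (hr : ∃ j ∈ J, r j ≠ 0) {κ : ℂ} (h : ∀ n, ∑ j ∈ J, r j * s (n + j) = κ) :
    ∃ N : ℕ, 0 < N ∧ ∀ n, s (n + N) = s n := by
  classical
  -- Zero coefficients are discarded so that both extreme ones are invertible.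
  have hne : (J.filter (fun j => r j ≠ 0)).Nonempty := by
    obtain ⟨j, hj, hrj⟩ := hr
    exact ⟨j, Finset.mem_filter.2 ⟨hj, hrj⟩⟩
  obtain ⟨J', hJ'⟩ : ∃ J', J' = J.filter (fun j => r j ≠ 0) := ⟨_, rfl⟩
  have h' : ∀ n, ∑ j ∈ J', r j * s (n + j) = κ := by
    intro n
    rw [← h n, hJ']
    refine Finset.sum_filter_of_ne fun j _ hj h0 => hj (by rw [h0, zero_mul])
  rw [← hJ'] at hne
  have hmem := fun j (hj : j ∈ J') => (Finset.mem_filter.1 (hJ' ▸ hj)).2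
  let a := J'.min' hne
  let b := J'.max' hne
  have : Finite (Set.range s) := hs
  obtain ⟨n₁, n₂, hlt, heq⟩ : ∃ n₁ n₂ : ℕ, n₁ < n₂ ∧
      ∀ i : Fin (b - a).toNat, s (n₁ + (i : ℕ)) = s (n₂ + (i : ℕ)) := by
    obtain ⟨n₁, n₂, hne, heq⟩ := Finite.exists_ne_map_eq_of_infinite
      (fun (n : ℕ) (i : Fin (b - a).toNat) => (⟨s (n + (i : ℕ)), _, rfl⟩ : Set.range s))
    have heq' : ∀ i : Fin (b - a).toNat, s (n₁ + (i : ℕ)) = s (n₂ + (i : ℕ)) :=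
      fun i => congrArg Subtype.val (congrFun heq i)
    rcases lt_or_gt_of_ne hne with hlt | hlt
    · exact ⟨n₁, n₂, hlt, heq'⟩
    · exact ⟨n₂, n₁, hlt, fun i => (heq' i).symm⟩
  refine ⟨n₂ - n₁, by omega, fun n => ?_⟩
  rw [← sub_eq_zero]
  refine recurrence_eq_zero (d := fun n => s (n + (n₂ - n₁ : ℕ)) - s n) (r := r) (J := J')
    (a := a) (b := b) (m := n₁)
    (J'.min'_mem hne) (J'.max'_mem hne) (fun j hj => ⟨J'.min'_le j hj, J'.le_max' j hj⟩)
    (hmem _ (J'.min'_mem hne)) (hmem _ (J'.max'_mem hne)) ?_ ?_ n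
  · intro k
    have h1 := h' (k + (n₂ - n₁ : ℕ))
    have h2 := h' k
    rw [← sub_eq_zero.2 (h1.trans h2.symm), ← Finset.sum_sub_distrib]
    refine Finset.sum_congr rfl fun j _ => ?_
    rw [show k + (n₂ - n₁ : ℕ) + j = k + j + (n₂ - n₁ : ℕ) by ring]
    ring
  · intro k hk1 hk2
    have h1 := heq ⟨(k - n₁).toNat, by omega⟩
    simp only at h1
    rw [show (n₁ : ℤ) + ((k - n₁).toNat : ℕ) = k by omega,
      show (n₂ : ℤ) + ((k - n₁).toNat : ℕ) = k + (n₂ - n₁ : ℕ) by omega] at h1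
    rw [h1, sub_self]

/-! ### Configurations that are periodic in a primitive direction -/

theorem eq_cross_smul_add {u u' : ℤ × ℤ} (huu : cross u u' = 1) (p : ℤ × ℤ) :
    p = cross p u' • u + cross u p • u' := by
  have e1 : p.1 = p.1 * cross u u' := by rw [huu, mul_one]
  have e2 : p.2 = p.2 * cross u u' := by rw [huu, mul_one]
  apply Prod.ext
  · rw [e1]; simp [cross]; ring
  · rw [e2]; simp [cross]; ring

/-- The eigenvalue relation collapses each line of `F` to one coefficient, so the constant sums
become a recurrence for `n ↦ θ (n • u')`; `hne` makes it nontrivial. -/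
theorem hasFullPeriod_of_eigen {θ : ℤ × ℤ → ℂ} (hθ : (Set.range θ).Finite) {u u' : ℤ × ℤ}
    (huu : cross u u' = 1) {ζ : ℂ} {m : ℕ} (hm : 0 < m) (hζ : ζ ^ m = 1)
    (heig : ∀ x, θ (x + u) = ζ * θ x) (F : Figure) {κ : ℂ} (hF : ∀ x, ∑ p ∈ F, θ (x + p) = κ)
    (hne : ∃ p₀ ∈ F, ∑ p ∈ F with cross u p = cross u p₀, ζ ^ (cross p u') ≠ 0) :
    HasFullPeriod θ := by
  classical
  have hζ0 : ζ ≠ 0 := by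
    rintro rfl
    rw [zero_pow hm.ne'] at hζ
    exact zero_ne_one hζ
  have heign : ∀ (n : ℕ) x, θ (x + n • u) = ζ ^ n * θ x := by
    intro n
    induction n with
    | zero => simp
    | succ n ih =>
      intro x
      rw [succ_nsmul, ← add_assoc, heig, ih, pow_succ']
      ring
  have heigz : ∀ (n : ℤ) x, θ (x + n • u) = ζ ^ n * θ x := by
    intro n x
    obtain ⟨k, rfl | rfl⟩ := n.eq_nat_or_neg
    · rw [natCast_zsmul, zpow_natCast]; exact heign k x
    · have := heign k (x + (-(k : ℤ)) • u)
      rw [neg_smul, natCast_zsmul, neg_add_cancel_right] at this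
      rw [this, neg_smul, natCast_zsmul, zpow_neg, zpow_natCast,
        inv_mul_cancel_left₀ (pow_ne_zero _ hζ0)]
  obtain ⟨N, hN, hper⟩ := exists_period_of_recurrence (s := fun n => θ (n • u'))
    (r := fun j => ∑ p ∈ F with cross u p = j, ζ ^ (cross p u')) (J := F.image (cross u))
    (κ := κ) (hθ.subset (by rintro _ ⟨n, rfl⟩; exact ⟨_, rfl⟩))
    (by
      obtain ⟨p₀, hp₀, h⟩ := hne
      exact ⟨_, Finset.mem_image_of_mem _ hp₀, h⟩)
    (by
      intro n
      rw [← hF (n • u'),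
        ← Finset.sum_fiberwise_of_maps_to (fun p hp => Finset.mem_image_of_mem (cross u) hp)]
      refine Finset.sum_congr rfl fun j _ => ?_
      rw [Finset.sum_mul]
      refine Finset.sum_congr rfl fun p hp => ?_
      obtain ⟨-, rfl⟩ := Finset.mem_filter.1 hp
      rw [← heigz, add_smul, add_assoc]
      conv_rhs => rw [eq_cross_smul_add huu p]
      congr 2
      abel)
  refine hasFullPeriod_of_cross (u := m • u) (v := N • u') ?_ ?_ ?_
  · simp only [cross, Prod.smul_fst, Prod.smul_snd] at huu ⊢
    simp only [nsmul_eq_mul]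
    have : (m : ℤ) * u.1 * (N * u'.2) - m * u.2 * (N * u'.1) = m * N := by
      linear_combination (m * N : ℤ) * huu
    rw [this]
    positivity
  · intro x
    rw [heign, hζ, one_mul]
  · intro x
    have h1 := hper (cross u x)
    rw [eq_cross_smul_add huu x]
    have e : cross x u' • u + cross u x • u' + N • u' =
        (cross u x + N) • u' + cross x u' • u := by
      rw [add_smul, natCast_zsmul]; abel
    rw [e, heigz, add_comm (cross x u' • u), heigz]
    rw [h1]

theorem hasFullPeriod_of_hasPeriodAlong {η : ℤ × ℤ → ℂ} (hη : (Set.range η).Finite)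
    {u u' : ℤ × ℤ} (huu : cross u u' = 1) (hper : HasPeriodAlong u η) (F : Figure) {κ : ℂ}
    (hF : ∀ x, ∑ p ∈ F, η (x + p) = κ)
    (hne : ∀ (ζ : ℂ) (m : ℕ), 0 < m → ζ ^ m = 1 →
      ∃ p₀ ∈ F, ∑ p ∈ F with cross u p = cross u p₀, ζ ^ (cross p u') ≠ 0) :
    HasFullPeriod η := by
  obtain ⟨m, hm, hper⟩ := hper
  let ω : ℂ := Complex.exp (2 * Real.pi * Complex.I / m)
  have hω : IsPrimitiveRoot ω m := Complex.isPrimitiveRoot_exp m hm.ne'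
  -- Up to the factor `m`, the projection onto the eigenspace of the shift by `u` with eigenvalue
  -- `ζ⁻¹`.
  let g : ℂ → AddMonoidAlgebra ℂ (ℤ × ℤ) := fun ζ =>
    ∑ i ∈ Finset.range m, AddMonoidAlgebra.single (i • u) (ζ ^ i)
  have hg : ∀ ζ x, convAct ℂ (g ζ) η x = ∑ i ∈ Finset.range m, ζ ^ i * η (x + i • u) := by
    intro ζ x
    simp only [g]
    rw [map_sum, LinearMap.sum_apply, Finset.sum_apply]
    exact Finset.sum_congr rfl fun i _ => convAct_single _ _ _ _
  have hFη : convAct ℂ (∑ p ∈ F, AddMonoidAlgebra.single p 1) η = fun _ => κ := by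
    funext x
    rw [convAct_sum_single, hF]
  have hfull : ∀ ζ : ℂ, ζ ^ m = 1 → HasFullPeriod (convAct ℂ (g ζ) η) := by
    intro ζ hζ
    have hζ0 : ζ ≠ 0 := by
      rintro rfl
      rw [zero_pow hm.ne'] at hζ
      exact zero_ne_one hζ
    have hζ' : ζ⁻¹ ^ m = 1 := by rw [inv_pow, hζ, inv_one]
    obtain ⟨κ', hκ'⟩ := convAct_const (g ζ) κ
    refine hasFullPeriod_of_eigen (convAct_finite_range _ _ hη) huu hm hζ' ?_ F (κ := κ') ?_
      (hne _ m hm hζ')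
    · intro x
      rw [hg, hg, eq_inv_mul_iff_mul_eq₀ hζ0, Finset.mul_sum]
      have h1 := Finset.sum_range_succ (fun i => ζ ^ i * η (x + i • u)) m
      rw [Finset.sum_range_succ'] at h1
      simp only [hζ, hper, pow_zero, zero_smul, add_zero, add_left_inj] at h1
      rw [← h1]
      refine Finset.sum_congr rfl fun i _ => ?_
      rw [pow_succ', succ_nsmul', add_assoc]
      ring
    · intro x
      have h1 := congrFun (convAct_comm (∑ p ∈ F, AddMonoidAlgebra.single p 1) (g ζ) η) x
      rwa [convAct_sum_single, hFη, hκ'] at h1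
  have hsum := HasFullPeriod.sum (Finset.range m) (fun k => convAct ℂ (g (ω ^ k)) η)
    fun k _ => hfull _ (by rw [← pow_mul, mul_comm, pow_mul, hω.pow_eq_one, one_pow])
  -- Fourier inversion on `ℤ/m`.
  have hinv : ∀ x, η x = (m : ℂ)⁻¹ * ∑ k ∈ Finset.range m, convAct ℂ (g (ω ^ k)) η x := by
    intro x
    rw [eq_inv_mul_iff_mul_eq₀ (by exact_mod_cast hm.ne')]
    simp only [hg]
    rw [Finset.sum_comm, Finset.sum_eq_single 0]
    · simp
    · intro i hi hi0
      rw [← Finset.sum_mul]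
      have h1 : ∀ k, (ω ^ k) ^ i = (ω ^ i) ^ k := fun k => pow_right_comm _ _ _
      simp only [h1]
      have h2 : ω ^ i ≠ 1 := hω.pow_ne_one_of_pos_of_lt hi0 (Finset.mem_range.1 hi)
      rw [geom_sum_eq h2, ← pow_mul, mul_comm i, pow_mul, hω.pow_eq_one, one_pow, sub_self,
        zero_div, zero_mul]
    · intro h0
      exact absurd (Finset.mem_range.2 hm) h0
  rw [show η = _ from funext hinv]
  exact hsum.comp _

/-! ### Lines in convex figures -/

theorem exists_primitive {u : ℤ × ℤ} (hu : u ≠ 0) :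
    ∃ (g : ℤ) (u₀ u' : ℤ × ℤ), g ≠ 0 ∧ u = g • u₀ ∧ cross u₀ u' = 1 := by
  have hg : Int.gcd u.1 u.2 ≠ 0 := by
    rw [Ne, Int.gcd_eq_zero_iff]
    exact fun h => hu (Prod.ext h.1 h.2)
  have hg' : (Int.gcd u.1 u.2 : ℤ) ≠ 0 := by exact_mod_cast hg
  obtain ⟨a, ha⟩ := Int.gcd_dvd_left u.1 u.2
  obtain ⟨b, hb⟩ := Int.gcd_dvd_right u.1 u.2
  have hbez := Int.gcd_eq_gcd_ab u.1 u.2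
  generalize (Int.gcd u.1 u.2 : ℤ) = g at *
  refine ⟨g, (a, b), (-Int.gcdB u.1 u.2, Int.gcdA u.1 u.2), hg', Prod.ext ha hb, ?_⟩
  apply mul_left_cancel₀ hg'
  simp only [cross]
  linear_combination -hbez - Int.gcdA u.1 u.2 * ha - Int.gcdB u.1 u.2 * hb

theorem lineLength_eq (F : Figure) (u p : ℤ × ℤ) :
    F.lineLength u p = (F.filter (fun q => cross u q = cross u p)).card := by
  unfold Figure.lineLength
  congr 1
  refine Finset.filter_congr fun q _ => ?_
  simp only [cross]
  constructor <;> intro h <;> linarith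

theorem lineLength_smul (F : Figure) {g : ℤ} (hg : g ≠ 0) (u p : ℤ × ℤ) :
    F.lineLength (g • u) p = F.lineLength u p := by
  rw [lineLength_eq, lineLength_eq]
  congr 1
  refine Finset.filter_congr fun q _ => ?_
  rw [smul_cross, smul_cross, mul_right_inj' hg]

theorem Figure.IsConvex.mem_of_between {F : Figure} (hF : F.IsConvex) {p u : ℤ × ℤ} {i j k : ℤ}
    (hij : i ≤ j) (hjk : j ≤ k) (hi : p + i • u ∈ F) (hk : p + k • u ∈ F) : p + j • u ∈ F := by
  rcases (hij.trans hjk).eq_or_lt with h | h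
  · rwa [show j = i by omega]
  · rw [← Finset.mem_coe, hF]
    have hki : (0 : ℝ) < k - i := by exact_mod_cast sub_pos.2 h
    have h1 := convex_convexHull ℝ (latticeToPlane '' (F : Set (ℤ × ℤ)))
      (subset_convexHull ℝ _ ⟨_, hi, rfl⟩) (subset_convexHull ℝ _ ⟨_, hk, rfl⟩)
      (a := ((k : ℝ) - j) / (k - i)) (b := ((j : ℝ) - i) / (k - i))
      (div_nonneg (by exact_mod_cast sub_nonneg.2 hjk) hki.le)
      (div_nonneg (by exact_mod_cast sub_nonneg.2 hij) hki.le)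
      (by field_simp; ring)
    refine (congrArg (· ∈ convexHull ℝ (latticeToPlane '' (F : Set (ℤ × ℤ)))) ?_).mp h1
    ext <;> simp [latticeToPlane] <;> field_simp <;> ring

/-- Convexity leaves no gaps between the extreme points of `F` on a line. The summand takes values
in an arbitrary monoid because both character sums and Laurent polynomials are needed. -/
theorem Figure.IsConvex.sum_line {F : Figure} (hF : F.IsConvex) {u u' : ℤ × ℤ}
    (huu : cross u u' = 1) {p₀ : ℤ × ℤ} (hp₀ : p₀ ∈ F) :
    ∃ b : ℤ × ℤ, ∀ {M : Type} [AddCommMonoid M] (f : ℤ × ℤ → M),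
      ∑ q ∈ F with cross u q = cross u p₀, f q =
        ∑ i ∈ Finset.range (F.lineLength u p₀), f (b + i • u) := by
  classical
  have hcoord : ∀ i p, cross (p + i • u) u' = cross p u' + i := by
    intro i p
    simp only [cross, Prod.fst_add, Prod.snd_add, Prod.smul_fst, Prod.smul_snd,
      smul_eq_mul] at huu ⊢
    linear_combination i * huu
  have hinj : Function.Injective (fun i : ℤ => p₀ + i • u) := by
    intro i j hij
    have := congrArg (fun p => cross p u') hij
    simp only [hcoord] at this
    omega
  let S : Finset ℤ := F.preimage _ hinj.injOn
  have hS : ∀ i, i ∈ S ↔ p₀ + i • u ∈ F := fun i => Finset.mem_preimage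
  have h0 : (0 : ℤ) ∈ S := by rw [hS]; simpa using hp₀
  let lo := S.min' ⟨0, h0⟩
  let hi := S.max' ⟨0, h0⟩
  have hlo : lo ∈ S := S.min'_mem _
  have hhi : hi ∈ S := S.max'_mem _
  let g : ℕ → ℤ × ℤ := fun i => p₀ + lo • u + i • u
  have hg : ∀ i : ℕ, g i = p₀ + (lo + i) • u := by
    intro i
    simp only [g]
    rw [add_smul, natCast_zsmul, add_assoc]
  have hginj : Function.Injective g := by
    intro i j hij
    rw [hg, hg] at hij
    have := hinj hij
    omega
  have himg : F.filter (fun q => cross u q = cross u p₀) =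
      (Finset.range (hi + 1 - lo).toNat).image g := by
    ext q
    rw [Finset.mem_filter, Finset.mem_image]
    constructor
    · rintro ⟨hq, hcr⟩
      have hq' : q = p₀ + (cross q u' - cross p₀ u') • u := by
        apply Prod.ext
        · have : q.1 * cross u u' = (p₀.1 + (cross q u' - cross p₀ u') * u.1) * 1 := by
            rw [huu]
            simp only [cross] at *
            linear_combination (-q.1 + p₀.1) * huu + u'.1 * hcr
          rw [huu] at this
          simpa using this
        · have : q.2 * cross u u' = (p₀.2 + (cross q u' - cross p₀ u') * u.2) * 1 := by
            rw [huu]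
            simp only [cross] at *
            linear_combination (-q.2 + p₀.2) * huu + u'.2 * hcr
          rw [huu] at this
          simpa using this
      have hmem : cross q u' - cross p₀ u' ∈ S := by rw [hS, ← hq']; exact hq
      have h1 := S.min'_le _ hmem
      have h2 := S.le_max' _ hmem
      refine ⟨(cross q u' - cross p₀ u' - lo).toNat, ?_, ?_⟩
      · rw [Finset.mem_range]
        change lo ≤ _ at h1
        change _ ≤ hi at h2
        omega
      · rw [hg]
        conv_rhs => rw [hq']
        congr 2
        change lo ≤ _ at h1
        omega
    · rintro ⟨i, hi', rfl⟩
      rw [Finset.mem_range] at hi'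
      rw [hg]
      refine ⟨hF.mem_of_between (i := lo) (k := hi) (by omega) (by omega) ((hS _).1 hlo)
        ((hS _).1 hhi), ?_⟩
      rw [cross_add, cross_smul]
      simp [cross, mul_comm]
  have hlen : F.lineLength u p₀ = (hi + 1 - lo).toNat := by
    rw [lineLength_eq, himg, Finset.card_image_of_injective _ hginj, Finset.card_range]
  refine ⟨p₀ + lo • u, fun f => ?_⟩
  rw [himg, hlen, Finset.sum_image hginj.injOn]

/-- Each line sum is a unit times `1 + ζ + ⋯ + ζ ^ (L - 1)`. If all vanished, the order of `ζ` would
divide every length `L`, so `ζ = 1`; but then the sum is `L`, which is positive. -/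
theorem Figure.IsRelativelyPrimeAlong.exists_line_sum_ne_zero {F : Figure} (hF : F.IsConvex)
    {u u' : ℤ × ℤ} (huu : cross u u' = 1) (hrp : F.IsRelativelyPrimeAlong u) (ζ : ℂ) (m : ℕ)
    (hm : 0 < m) (hζ : ζ ^ m = 1) :
    ∃ p₀ ∈ F, ∑ p ∈ F with cross u p = cross u p₀, ζ ^ (cross p u') ≠ 0 := by
  have hζ0 : ζ ≠ 0 := by
    rintro rfl
    rw [zero_pow hm.ne'] at hζ
    exact zero_ne_one hζ
  by_contra! hcon
  have hgeom : ∀ p₀ ∈ F, ∑ i ∈ Finset.range (F.lineLength u p₀), ζ ^ i = 0 := by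
    intro p₀ hp₀
    obtain ⟨b, hb⟩ := hF.sum_line huu hp₀
    have h1 := hcon p₀ hp₀
    rw [hb] at h1
    have h2 : ∀ i : ℕ, ζ ^ (cross (b + i • u) u') = ζ ^ (cross b u') * ζ ^ i := by
      intro i
      rw [← zpow_natCast, ← zpow_add₀ hζ0]
      congr 1
      simp only [cross, Prod.fst_add, Prod.snd_add, Prod.smul_fst, Prod.smul_snd]
        at huu ⊢
      simp only [nsmul_eq_mul]
      linear_combination i * huu
    simp only [h2] at h1
    rw [← Finset.mul_sum] at h1
    exact (mul_eq_zero.1 h1).resolve_left (zpow_ne_zero _ hζ0)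
  have hdvd : orderOf ζ ∣ F.gcd (fun p => F.lineLength u p) := by
    refine Finset.dvd_gcd fun p hp => ?_
    rw [orderOf_dvd_iff_pow_eq_one, ← sub_eq_zero, ← geom_sum_mul, hgeom p hp, zero_mul]
  rw [hrp, Nat.dvd_one, orderOf_eq_one_iff] at hdvd
  subst hdvd
  have hne : F.Nonempty := by
    rw [Finset.nonempty_iff_ne_empty]
    rintro rfl
    simp [Figure.IsRelativelyPrimeAlong] at hrp
  obtain ⟨p, hp⟩ := hne
  have h1 := hgeom p hp
  simp only [one_pow, Finset.sum_const, Finset.card_range, nsmul_eq_mul, mul_one,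
    Nat.cast_eq_zero] at h1
  rw [lineLength_eq, Finset.card_eq_zero] at h1
  exact Finset.notMem_empty p (h1 ▸ Finset.mem_filter.2 ⟨hp, rfl⟩)

/-! ### From common divisors of line lengths to strongly linear divisors -/

theorem stronglyLinear_dvd_poly {F : Figure} (hF : F.IsConvex) {u u' : ℤ × ℤ}
    (huu : cross u u' = 1) {l : ℕ} (hl : ∀ p ∈ F, l + 1 ∣ F.lineLength u p) :
    stronglyLinear u l ∣ F.poly := by
  classical
  have hpow : ∀ i : ℕ, AddMonoidAlgebra.single (i • u) (1 : ℤ) =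
      (AddMonoidAlgebra.single u 1 : Laurent2) ^ i := by
    intro i
    rw [AddMonoidAlgebra.single_pow, one_pow]
  unfold Figure.poly
  rw [← Finset.sum_fiberwise_of_maps_to (fun p hp => Finset.mem_image_of_mem (cross u) hp)]
  refine Finset.dvd_sum fun j hj => ?_
  obtain ⟨p₀, hp₀, rfl⟩ := Finset.mem_image.1 hj
  obtain ⟨b, hb⟩ := hF.sum_line huu hp₀
  obtain ⟨k, hk⟩ := hl p₀ hp₀
  have hone : ∀ i : ℕ, AddMonoidAlgebra.single (b + i • u) (1 : ℤ) =
      AddMonoidAlgebra.single b 1 * (AddMonoidAlgebra.single u 1 : Laurent2) ^ i := by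
    intro i
    rw [← hpow, AddMonoidAlgebra.single_mul_single, one_mul]
  have hsl : stronglyLinear u l =
      ∑ i ∈ Finset.range (l + 1), (AddMonoidAlgebra.single u 1 : Laurent2) ^ i :=
    Finset.sum_congr rfl fun i _ => hpow i
  rw [hb, hk, hsl]
  clear hk
  simp only [hone]
  rw [← Finset.mul_sum]
  refine Dvd.dvd.mul_left ?_ _
  generalize (AddMonoidAlgebra.single u 1 : Laurent2) = X
  induction k with
  | zero => simp
  | succ k ih =>
    rw [mul_add, mul_one, Finset.sum_range_add _ ((l + 1) * k)]
    refine dvd_add ih ?_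
    simp only [pow_add]
    rw [← Finset.mul_sum]
    exact dvd_mul_left _ _

theorem Figure.poly_translate (F : Figure) (t : ℤ × ℤ) :
    (F.translate t).poly = AddMonoidAlgebra.single t 1 * F.poly := by
  classical
  unfold Figure.poly Figure.translate
  rw [Finset.sum_image (fun p _ q _ h => add_right_cancel h), Finset.mul_sum]
  refine Finset.sum_congr rfl fun p _ => ?_
  rw [AddMonoidAlgebra.single_mul_single, one_mul, add_comm]

theorem hasStronglyLinearDivisor_of_not_isRelativelyPrimeAlong {F : Figure} (hF : F.IsConvex)
    {u : ℤ × ℤ} (hu : u ≠ 0) (h : ¬ F.IsRelativelyPrimeAlong u) :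
    HasStronglyLinearDivisor F.poly := by
  rcases F.eq_empty_or_nonempty with rfl | ⟨p, hp⟩
  -- The empty figure has gcd `0` and polynomial `0`, which everything divides.
  · exact ⟨(1, 0), 1, by simp, le_rfl, by simp [Figure.poly]⟩
  · obtain ⟨g, u₀, u', hg, rfl, huu⟩ := exists_primitive hu
    unfold Figure.IsRelativelyPrimeAlong at h
    simp only [lineLength_smul F hg] at h
    have hu₀ : u₀ ≠ 0 := by rintro rfl; simp [cross] at huu
    have hne : F.gcd (fun p => F.lineLength u₀ p) ≠ 0 := by
      intro h0
      rw [Finset.gcd_eq_zero_iff] at h0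
      have h1 := h0 p hp
      rw [lineLength_eq, Finset.card_eq_zero] at h1
      exact Finset.notMem_empty p (h1 ▸ Finset.mem_filter.2 ⟨hp, rfl⟩)
    refine ⟨u₀, F.gcd (fun p => F.lineLength u₀ p) - 1, hu₀, by omega,
      stronglyLinear_dvd_poly hF huu fun q hq => ?_⟩
    rw [Nat.sub_add_cancel (by omega)]
    exact Finset.gcd_dvd hq

/-! ### Decomposition into periodic configurations by averaging -/

/-- For each `j`, the dilated identity isolates the term at `0`: `c x` is `k` minus the sum of `c (x
+ (1 + |F|! j) • p)` over the other `p`. Averages over `j` are bounded, and limits along one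
ultrafilter exist for all `p` and `x` while respecting sums. -/
theorem exists_periodic_decomposition (F : Figure) (h0 : (0 : ℤ × ℤ) ∈ F) (c : ℤ × ℤ → ℤ)
    (hc : ∀ x, c x = 0 ∨ c x = 1) (k : ℤ) (h : ∀ x, ∑ p ∈ F, c (x + p) = k) :
    ∃ φ : ℤ × ℤ → ℤ × ℤ → ℂ, (∀ p x, ‖φ p x‖ ≤ 1) ∧
      (∀ p x, φ p (x + F.card.factorial • p) = φ p x) ∧
      ∀ x, (c x : ℂ) = k - ∑ p ∈ F.erase 0, φ p x := by
  obtain ⟨M, hM⟩ : ∃ M, M = F.card.factorial := ⟨_, rfl⟩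
  have hdil := sum_dilate_factorial F ⟨0, h0⟩ c hc k h
  rw [← hM] at hdil ⊢
  have hcn : ∀ x, ‖(c x : ℂ)‖ ≤ 1 := fun x => by
    rcases hc x with h | h <;> rw [h] <;> norm_num
  let avg : ℤ × ℤ → ℤ × ℤ → ℕ → ℂ := fun p x N =>
    (∑ j ∈ Finset.range N, (c (x + (1 + M * j) • p) : ℂ)) / N
  have havg : ∀ p x N, ‖avg p x N‖ ≤ 1 := by
    intro p x N
    rw [norm_div, Complex.norm_natCast]
    refine div_le_one_of_le₀ ((norm_sum_le _ _).trans ?_) N.cast_nonneg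
    exact (Finset.sum_le_sum fun j _ => hcn _).trans (by simp)
  have hlim : ∀ p x, ∃ z : ℂ, ‖z‖ ≤ 1 ∧
      Filter.Tendsto (avg p x) (Filter.hyperfilter ℕ) (nhds z) := by
    intro p x
    obtain ⟨z, hz, hle⟩ := (isCompact_closedBall (0 : ℂ) 1).ultrafilter_le_nhds
      ((Filter.hyperfilter ℕ).map (avg p x)) (by
        rw [Filter.le_principal_iff, Ultrafilter.mem_coe, Ultrafilter.mem_map]
        exact Filter.univ_mem' fun N => mem_closedBall_zero_iff.2 (havg p x N))
    exact ⟨z, by simpa using hz, hle⟩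
  choose φ hφ1 hφ using hlim
  refine ⟨φ, hφ1, fun p x => ?_, fun x => ?_⟩
  · rw [← sub_eq_zero]
    refine tendsto_nhds_unique ((hφ p (x + M • p)).sub (hφ p x)) ?_
    refine Filter.Tendsto.mono_left ?_ Nat.hyperfilter_le_atTop
    refine squeeze_zero_norm (a := fun N : ℕ => 2 / (N : ℝ)) (fun N => ?_)
      (tendsto_const_div_atTop_nhds_zero_nat 2)
    -- Translation by `M • p` moves the index `j` by one, so only the two end terms survive.
    have e1 : avg p (x + M • p) N - avg p x N =
        ((c (x + (1 + M * N) • p) : ℂ) - c (x + p)) / N := by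
      simp only [avg]
      rw [← sub_div]
      congr 1
      have h1 := Finset.sum_range_succ (fun j => (c (x + (1 + M * j) • p) : ℂ)) N
      rw [Finset.sum_range_succ'] at h1
      have h2 : ∀ j, x + M • p + (1 + M * j) • p = x + (1 + M * (j + 1)) • p := by
        intro j
        rw [add_assoc, ← add_smul]
        congr 2
        ring
      simp only [h2]
      rw [mul_zero, add_zero, one_smul] at h1
      linear_combination h1
    rw [e1, norm_div, Complex.norm_natCast]
    gcongr
    exact (norm_sub_le _ _).trans (by linarith [hcn (x + (1 + M * N) • p), hcn (x + p)])
  · have h1 := tendsto_finsetSum (F.erase 0) fun p _ => hφ p x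
    have h2 : Filter.Tendsto (fun N => ∑ p ∈ F.erase 0, avg p x N) (Filter.hyperfilter ℕ)
        (nhds ((k : ℂ) - c x)) := by
      refine Filter.Tendsto.mono_left ?_ Nat.hyperfilter_le_atTop
      refine tendsto_const_nhds.congr' ?_
      filter_upwards [Filter.eventually_gt_atTop 0] with N hN
      have hN' : (N : ℂ) ≠ 0 := by exact_mod_cast hN.ne'
      simp only [avg]
      rw [← Finset.sum_div, Finset.sum_comm, eq_div_iff hN']
      have h3 : ∀ j : ℕ, ∑ p ∈ F.erase 0, (c (x + (1 + M * j) • p) : ℂ) = k - c x := by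
        intro j
        have h4 := hdil j x
        rw [← Finset.add_sum_erase F _ h0, smul_zero, add_zero] at h4
        rw [← h4]
        push_cast
        ring
      simp only [h3]
      rw [Finset.sum_const, Finset.card_range, nsmul_eq_mul, mul_comm]
    rw [tendsto_nhds_unique h1 h2]
    ring

/-! ### Configurations with constant sums over a relatively prime figure -/

theorem cross_eq_zero_trans {p q r : ℤ × ℤ} (hp : p ≠ 0) (h1 : cross p q = 0)
    (h2 : cross p r = 0) : cross q r = 0 := by
  by_contra hne
  refine hp (Prod.ext ?_ ?_)
  · refine (mul_eq_zero (a := p.1) (b := cross q r) |>.1 ?_).resolve_right hne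
    simp only [cross] at *
    linear_combination q.1 * h2 - r.1 * h1
  · refine (mul_eq_zero (a := p.2) (b := cross q r) |>.1 ?_).resolve_right hne
    simp only [cross] at *
    linear_combination q.2 * h2 - r.2 * h1

theorem cross_comm_eq_zero {p q : ℤ × ℤ} : cross p q = 0 ↔ cross q p = 0 := by
  simp only [cross]
  constructor <;> intro h <;> linarith

-- Summing over all `p` instead of representatives of directions counts each `φ q` once per element
-- of its parallel class, which the weight corrects. Parallelism is transitive because `0 ∉ E`.
open Classical in
theorem sum_eq_sum_parallel (E : Finset (ℤ × ℤ)) (hE : (0 : ℤ × ℤ) ∉ E) (φ : ℤ × ℤ → ℂ) :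
    ∑ q ∈ E, φ q = ∑ p ∈ E, ((E.filter (fun q => cross p q = 0)).card : ℂ)⁻¹ *
      ∑ q ∈ E with cross p q = 0, φ q := by
  have hE' : ∀ p ∈ E, p ≠ 0 := fun p hp h => hE (h ▸ hp)
  simp only [Finset.sum_filter, Finset.mul_sum, mul_ite, mul_zero]
  rw [Finset.sum_comm]
  refine Finset.sum_congr rfl fun q hq => ?_
  have h1 : ∀ p ∈ E, (if cross p q = 0 then
      ((E.filter (fun q => cross p q = 0)).card : ℂ)⁻¹ * φ q else 0) =
      if cross q p = 0 then ((E.filter (fun r => cross q r = 0)).card : ℂ)⁻¹ * φ q else 0 := by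
    intro p hp
    by_cases hpq : cross p q = 0
    · have hqp := cross_comm_eq_zero.1 hpq
      rw [if_pos hpq, if_pos hqp]
      congr 4
      refine Finset.filter_congr fun r _ => ?_
      exact ⟨cross_eq_zero_trans (hE' p hp) hpq, cross_eq_zero_trans (hE' q hq) hqp⟩
    · rw [if_neg hpq, if_neg (fun h => hpq (cross_comm_eq_zero.1 h))]
  rw [Finset.sum_congr rfl h1, ← Finset.sum_filter, Finset.sum_const, nsmul_eq_mul,
    mul_inv_cancel_left₀]
  rw [Nat.cast_ne_zero]
  refine (Finset.card_pos.2 ⟨q, Finset.mem_filter.2 ⟨hq, ?_⟩⟩).ne'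
  simp [cross, mul_comm]

theorem hasFullPeriod_of_sum_const {F : Figure} (hF : F.IsConvex) (h0 : (0 : ℤ × ℤ) ∈ F)
    (hrp : ∀ u : ℤ × ℤ, u ≠ 0 → F.IsRelativelyPrimeAlong u) (c : ℤ × ℤ → ℤ)
    (hc : ∀ x, c x = 0 ∨ c x = 1) (k : ℤ) (h : ∀ x, ∑ p ∈ F, c (x + p) = k) :
    HasFullPeriod c := by
  classical
  obtain ⟨φ, hφ1, hφM, hφ⟩ := exists_periodic_decomposition F h0 c hc k h
  have hM := F.card.factorial_pos
  generalize F.card.factorial = M at *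
  let E := F.erase 0
  have hE : ∀ p ∈ E, p ≠ 0 := fun p hp => Finset.ne_of_mem_erase hp
  let cC : ℤ × ℤ → ℂ := fun x => c x
  let ψ : ℤ × ℤ → ℤ × ℤ → ℂ := fun p x => ∑ q ∈ E with cross p q = 0, φ q x
  have hψ : ∀ p ∈ E, HasFullPeriod (ψ p) := by
    intro p hp
    obtain ⟨g₀, u, u', hg₀, hpu, huu⟩ := exists_primitive (hE p hp)
    have hu : u ≠ 0 := by rintro rfl; simp [cross] at huu
    have hcross : ∀ q, cross p q = 0 ↔ cross u q = 0 := by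
      intro q
      rw [hpu, smul_cross, mul_eq_zero, or_iff_right hg₀]
    have hper : HasPeriodAlong u (ψ p) := by
      refine HasPeriodAlong.sum _ φ fun q hq => ?_
      obtain ⟨hqE, hq⟩ := Finset.mem_filter.1 hq
      rw [hcross] at hq
      have hqu := eq_cross_smul_add huu q
      rw [hq, zero_smul, add_zero] at hqu
      have hne : cross q u' ≠ 0 := by
        intro h0
        rw [h0, zero_smul] at hqu
        exact hE q hqE hqu
      -- Here `q = cross q u' • u`, so this multiple of `u` is `± M • q`.
      refine ⟨M * (cross q u').natAbs, Nat.mul_pos hM (Int.natAbs_pos.2 hne), fun x => ?_⟩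
      rcases Int.natAbs_eq (cross q u') with he | he
      · have : (M * (cross q u').natAbs) • u = (1 : ℤ) • (M • q) := by
          rw [mul_smul, ← natCast_zsmul u, ← he, ← hqu, one_smul]
        rw [this]
        exact period_zsmul (hφM q) 1 x
      · have : (M * (cross q u').natAbs) • u = (-1 : ℤ) • (M • q) := by
          rw [mul_smul, ← natCast_zsmul u, ← neg_eq_iff_eq_neg.2 he, neg_smul, ← hqu, smul_neg,
            neg_smul, one_smul]
        rw [this]
        exact period_zsmul (hφM q) (-1) x
    have hbd : ∃ B, ∀ x, ‖ψ p x‖ ≤ B :=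
      ⟨(E.filter (fun q => cross p q = 0)).card, fun x =>
        (norm_sum_le _ _).trans ((Finset.sum_le_sum fun q _ => hφ1 q x).trans (by simp))⟩
    let T := E.filter (fun q => cross p q ≠ 0)
    let g : AddMonoidAlgebra ℂ (ℤ × ℤ) :=
      ∏ q ∈ T, (AddMonoidAlgebra.single (M • q) 1 - 1)
    have hgφ : ∀ q ∈ T, convAct ℂ g (φ q) = 0 := by
      intro q hq
      simp only [g]
      rw [← Finset.mul_prod_erase T _ hq, mul_comm, convAct_mul]
      have : convAct ℂ (AddMonoidAlgebra.single (M • q) 1 - 1) (φ q) = 0 := by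
        funext x
        rw [convAct_single_sub_one, hφM, sub_self]
        rfl
      rw [this, map_zero]
    obtain ⟨κ₁, hκ₁⟩ := convAct_const g (k : ℂ)
    -- Since `g` kills the other directions, `ψ p` may be replaced by a constant minus `c`; this
    -- brings in finitely many values and constant sums over `F`.
    have hη : convAct ℂ g (ψ p) = (fun _ => κ₁) - convAct ℂ g cC := by
      have h1 : ψ p = (fun _ => (k : ℂ)) - cC - ∑ q ∈ T, φ q := by
        funext x
        have h2 := Finset.sum_filter_add_sum_filter_not E (fun q => cross p q = 0)
          (fun q => φ q x)
        have h3 := hφ x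
        simp only [Pi.sub_apply, Finset.sum_apply, ψ, cC, T]
        linear_combination h2 + h3
      rw [h1, map_sub, map_sub, map_sum, Finset.sum_eq_zero hgφ, hκ₁, sub_zero]
    have hcfin : (Set.range cC).Finite := by
      refine (Set.toFinite {0, 1}).subset ?_
      rintro _ ⟨x, rfl⟩
      rcases hc x with h | h <;> simp [cC, h]
    have hηfin : (Set.range (convAct ℂ g (ψ p))).Finite := by
      rw [hη]
      refine ((convAct_finite_range g cC hcfin).image (fun z => κ₁ - z)).subset ?_
      rintro _ ⟨x, rfl⟩
      exact ⟨_, ⟨x, rfl⟩, rfl⟩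
    have hFc : convAct ℂ (∑ p ∈ F, AddMonoidAlgebra.single p 1) cC = fun _ => (k : ℂ) := by
      funext x
      rw [convAct_sum_single, ← h x]
      push_cast
      rfl
    obtain ⟨κ₂, hκ₂⟩ := convAct_const (∑ p ∈ F, AddMonoidAlgebra.single p 1) κ₁
    have hFη : ∀ x, ∑ q ∈ F, convAct ℂ g (ψ p) (x + q) = κ₂ - κ₁ := by
      intro x
      rw [← convAct_sum_single F (fun q => q), hη, map_sub, hκ₂, convAct_comm, hFc, hκ₁]
      rfl
    obtain ⟨N, hN, hperN⟩ := hper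
    have hηfull := hasFullPeriod_of_hasPeriodAlong hηfin huu
      ⟨N, hN, convAct_shift g _ hperN⟩ F hFη
      ((hrp u hu).exists_line_sum_ne_zero hF huu)
    refine hasFullPeriod_of_prod_difference hbd hperN T (fun q => M • q) (fun q hq => ?_) hηfull
    have h1 := (Finset.mem_filter.1 hq).2
    rw [Ne, hcross] at h1
    rw [← natCast_zsmul, ← natCast_zsmul, cross_smul, smul_cross]
    exact mul_ne_zero (by exact_mod_cast hM.ne') (mul_ne_zero (by exact_mod_cast hN.ne') h1)
  have hsum := HasFullPeriod.sum E
    (fun p x => ((E.filter (fun q => cross p q = 0)).card : ℂ)⁻¹ * ψ p x)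
    fun p hp => (hψ p hp).comp _
  obtain ⟨N, hN, hper⟩ := hsum.comp (fun z => (k : ℂ) - z)
  refine ⟨N, hN, fun v x => ?_⟩
  have h1 := hper v x
  simp only [ψ] at h1
  rw [← sum_eq_sum_parallel E (Finset.notMem_erase _ _) (fun q => φ q x),
    ← sum_eq_sum_parallel E (Finset.notMem_erase _ _) (fun q => φ q (x + N • v)),
    ← hφ, ← hφ] at h1
  exact_mod_cast h1

/-! ### Abelian complexity one -/

open Classical in
theorem letterCount_translate {A : Type*} (w : ℤ × ℤ → A) (F : Figure) (t : ℤ × ℤ) (a : A) :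
    (letterCount w (F.translate t) a : ℤ) = ∑ p ∈ F, if w (t + p) = a then 1 else 0 := by
  unfold letterCount Figure.translate
  rw [Finset.card_filter, Nat.cast_sum,
    Finset.sum_image (fun p _ q _ h => add_right_cancel h)]
  refine Finset.sum_congr rfl fun p _ => ?_
  rw [add_comm p t]
  push_cast
  rfl

open Classical in
theorem abelianComplexity_eq_one_iff {A : Type*} (w : ℤ × ℤ → A) (F : Figure) :
    abelianComplexity w {G | ∃ t : ℤ × ℤ, G = F.translate t} = 1 ↔
      ∀ a, ∃ k : ℤ, ∀ x, ∑ p ∈ F, (if w (x + p) = a then 1 else 0) = k := by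
  unfold abelianComplexity
  rw [Set.encard_eq_one]
  constructor
  · rintro ⟨f, hf⟩ a
    refine ⟨f a, fun x => ?_⟩
    have h1 : letterCount w (F.translate x) ∈ ({f} : Set (A → ℕ)) := hf ▸ ⟨_, ⟨x, rfl⟩, rfl⟩
    rw [← letterCount_translate, Set.mem_singleton_iff.1 h1]
  · intro h
    refine ⟨letterCount w (F.translate 0), Set.eq_singleton_iff_unique_mem.2
      ⟨⟨_, ⟨0, rfl⟩, rfl⟩, ?_⟩⟩
    rintro _ ⟨_, ⟨t, rfl⟩, rfl⟩
    funext a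
    obtain ⟨k, hk⟩ := h a
    have h1 := letterCount_translate w F t a
    have h2 := letterCount_translate w F 0 a
    rw [hk] at h1 h2
    exact_mod_cast h1.trans h2.symm

theorem Figure.translate_translate (F : Figure) (s t : ℤ × ℤ) :
    (F.translate s).translate t = F.translate (s + t) := by
  unfold Figure.translate
  rw [Finset.image_image]
  refine Finset.image_congr fun p _ => ?_
  simp only [Function.comp, add_assoc]

theorem IsPattern.eq_translates {P : Set Figure} (hP : IsPattern P) {F : Figure} (hF : F ∈ P) :
    P = {G | ∃ t : ℤ × ℤ, G = F.translate t} := by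
  obtain ⟨F₀, rfl⟩ := hP
  obtain ⟨s, rfl⟩ := hF
  ext G
  constructor
  · rintro ⟨t, rfl⟩
    exact ⟨t - s, by rw [Figure.translate_translate, add_sub_cancel]⟩
  · rintro ⟨t, rfl⟩
    exact ⟨s + t, Figure.translate_translate _ _ _⟩

theorem IsPattern.nonempty {P : Set Figure} (hP : IsPattern P) : P.Nonempty := by
  obtain ⟨F, rfl⟩ := hP
  exact ⟨_, 0, rfl⟩

theorem IsRelativelyPrimePattern.isAbelianRigid {P : Set Figure} (hP : IsPattern P)
    (hconv : IsConvexPattern P) (hrp : IsRelativelyPrimePattern P) : IsAbelianRigid P := by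
  classical
  intro A _ w hw
  obtain ⟨G, hG⟩ := hP.nonempty
  obtain ⟨p₀, hp₀⟩ : G.Nonempty := by
    rw [Finset.nonempty_iff_ne_empty]
    rintro rfl
    simpa [Figure.IsRelativelyPrimeAlong] using hrp (1, 0) (by simp) _ hG
  have hF : G.translate (-p₀) ∈ P := by
    rw [hP.eq_translates hG]; exact ⟨_, rfl⟩
  have h0 : (0 : ℤ × ℤ) ∈ G.translate (-p₀) :=
    Finset.mem_image.2 ⟨p₀, hp₀, add_neg_cancel _⟩
  generalize G.translate (-p₀) = F at hF h0
  rw [hP.eq_translates hF, abelianComplexity_eq_one_iff] at hw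
  have hfull : ∀ a, HasFullPeriod (fun x => if w x = a then (1 : ℤ) else 0) := by
    intro a
    obtain ⟨k, hk⟩ := hw a
    refine hasFullPeriod_of_sum_const (hconv F hF) h0 (fun u hu => hrp u hu F hF) _
      (fun x => ?_) k hk
    by_cases h : w x = a <;> simp [h]
  have := Fintype.ofFinite A
  obtain ⟨N, hN, h⟩ := HasFullPeriod.common Finset.univ _ fun a _ => hfull a
  refine HasFullPeriod.isFullyPeriodic ⟨N, hN, fun v x => ?_⟩
  have h1 := h (w x) (Finset.mem_univ _) v x
  simpa using h1

/-! ### Words that are not fully periodic -/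

theorem exists_line_coordinate {v : ℤ × ℤ} (hv : v ≠ 0) :
    ∃ (κ : ℤ × ℤ → ℤ) (y : ℤ × ℤ), (∀ x, κ (x + v) = κ x + 1) ∧ (∀ n : ℕ, κ (n • y) = 0) ∧
      cross v y ≠ 0 := by
  by_cases h1 : v.1 = 0
  · have h2 : v.2 ≠ 0 := fun h2 => hv (Prod.ext h1 h2)
    refine ⟨fun x => x.2 / v.2, (1, 0), fun x => ?_, fun n => ?_, ?_⟩
    · simp only [Prod.snd_add]
      rw [Int.add_ediv_of_dvd_right dvd_rfl, Int.ediv_self h2]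
    · simp
    · simpa [cross] using h2
  · refine ⟨fun x => x.1 / v.1, (0, 1), fun x => ?_, fun n => ?_, ?_⟩
    · simp only [Prod.fst_add]
      rw [Int.add_ediv_of_dvd_right dvd_rfl, Int.ediv_self h1]
    · simp
    · simpa [cross] using h1

/-- Moving the window by one swaps `a` for `a + N`, which is in the same class modulo `N`. -/
theorem sum_range_dvd_const (N : ℕ) (a : ℤ) :
    (∑ i ∈ Finset.range N, if (N : ℤ) ∣ a + i then (1 : ℤ) else 0) =
      ∑ i ∈ Finset.range N, if (N : ℤ) ∣ i then (1 : ℤ) else 0 := by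
  have step : ∀ a : ℤ, (∑ i ∈ Finset.range N, if (N : ℤ) ∣ a + 1 + i then (1 : ℤ) else 0) =
      ∑ i ∈ Finset.range N, if (N : ℤ) ∣ a + i then (1 : ℤ) else 0 := by
    intro a
    have h1 := Finset.sum_range_succ (fun i : ℕ => if (N : ℤ) ∣ a + i then (1 : ℤ) else 0) N
    rw [Finset.sum_range_succ'] at h1
    simp only [dvd_add_self_right, Nat.cast_zero, add_zero, Nat.cast_add, Nat.cast_one,
      add_left_inj] at h1
    rw [← h1]
    simp only [add_assoc, add_comm (1 : ℤ)]
  induction a using Int.induction_on with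
  | zero => simp
  | succ n ih => rw [step, ih]
  | pred n ih => rw [← step, sub_add_cancel, ih]

theorem not_isAbelianRigid_of_hasStronglyLinearDivisor {P : Set Figure} (hP : IsPattern P)
    {F : Figure} (hF : F ∈ P) (h : HasStronglyLinearDivisor F.poly) : ¬ IsAbelianRigid P := by
  classical
  obtain ⟨v, l, hv, hl, g, hg⟩ := h
  obtain ⟨κ, y, hκv, hκy, hvy⟩ := exists_line_coordinate hv
  -- The extra `1` is the phase shift on the line through the origin parallel to `v`.
  let τ : ℤ × ℤ → ℤ := fun x => κ x + if cross v x = 0 then 1 else 0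
  have hτ : ∀ (i : ℕ) x, τ (x + i • v) = τ x + i := by
    intro i
    induction i with
    | zero => simp
    | succ i ih =>
      intro x
      have hvv : cross v v = 0 := by simp [cross, mul_comm]
      rw [succ_nsmul, ← add_assoc]
      have : ∀ x, τ (x + v) = τ x + 1 := by
        intro x
        simp only [τ]
        rw [hκv, cross_add, hvv, add_zero]
        ring
      rw [this, ih]
      push_cast
      ring
  let w : ℤ × ℤ → Bool := fun x => decide (((l + 1 : ℕ) : ℤ) ∣ τ x)
  have hconst : ∃ k : ℤ, ∀ x, ∑ p ∈ F, (if w (x + p) = true then (1 : ℤ) else 0) = k := by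
    let c : ℤ × ℤ → ℤ := fun x => if w x = true then 1 else 0
    have h1 : convAct ℤ (stronglyLinear v l) c = fun _ =>
        ∑ i ∈ Finset.range (l + 1), if ((l + 1 : ℕ) : ℤ) ∣ i then (1 : ℤ) else 0 := by
      funext x
      unfold stronglyLinear
      rw [convAct_sum_single, ← sum_range_dvd_const (l + 1) (τ x)]
      refine Finset.sum_congr rfl fun i _ => ?_
      simp only [c, w, decide_eq_true_eq, hτ]
    obtain ⟨k, hk⟩ := convAct_const g
      (∑ i ∈ Finset.range (l + 1), if ((l + 1 : ℕ) : ℤ) ∣ i then (1 : ℤ) else 0)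
    refine ⟨k, fun x => ?_⟩
    have h2 := convAct_sum_single F (fun p => p) c x
    rw [show ∑ p ∈ F, AddMonoidAlgebra.single p (1 : ℤ) = g * stronglyLinear v l from
      hg.trans (mul_comm _ _), convAct_mul, h1, hk] at h2
    exact h2.symm
  intro hrigid
  have hper := hrigid Bool w (by
    rw [hP.eq_translates hF, abelianComplexity_eq_one_iff]
    obtain ⟨k, hk⟩ := hconst
    rintro (_ | _)
    · refine ⟨F.card - k, fun x => ?_⟩
      rw [← hk x, Finset.cast_card, ← Finset.sum_sub_distrib]
      refine Finset.sum_congr rfl fun p _ => ?_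
      cases w (x + p) <;> simp
    · refine ⟨k, fun x => ?_⟩
      rw [← hk x]
      refine Finset.sum_congr rfl fun p _ => ?_
      cases w (x + p) <;> simp)
  obtain ⟨N, hN, hper⟩ := hper.hasFullPeriod
  -- At `0` the phase is `1`, at `N • y` it is `0`; as `l + 1 ≥ 2`, only the latter is divisible by
  -- `l + 1`.
  have h1 := hper y 0
  have h2 : cross v (N • y) ≠ 0 := by
    rw [← natCast_zsmul, cross_smul]
    exact mul_ne_zero (by exact_mod_cast hN.ne') hvy
  have h3 : κ 0 = 0 := by simpa using hκy 0
  have h4 : cross v 0 = 0 := by simp [cross]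
  simp only [w, τ, zero_add, hκy, h2, h3, h4, if_true, if_false, add_zero] at h1
  have h5 : ¬ ((l + 1 : ℕ) : ℤ) ∣ 1 := by
    intro hd
    have := Int.le_of_dvd one_pos hd
    omega
  exact h5 ((decide_eq_decide.1 h1).1 (dvd_zero _))

theorem mainTheorem1 (P : Set Figure) (hP : IsPattern P) (hconv : IsConvexPattern P) :
    (∀ F ∈ P, HasStronglyLinearDivisor F.poly ↔ ¬ IsAbelianRigid P) ∧
    (IsAbelianRigid P ↔ IsRelativelyPrimePattern P) := by
  have key : ¬ IsRelativelyPrimePattern P → ∀ F ∈ P, HasStronglyLinearDivisor F.poly := by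
    intro h F hF
    unfold IsRelativelyPrimePattern at h
    push Not at h
    obtain ⟨u, hu, G, hG, hrp⟩ := h
    obtain ⟨v, l, hv, hl, hd⟩ :=
      hasStronglyLinearDivisor_of_not_isRelativelyPrimeAlong (hconv G hG) hu hrp
    rw [hP.eq_translates hG] at hF
    obtain ⟨t, rfl⟩ := hF
    exact ⟨v, l, hv, hl, by rw [Figure.poly_translate]; exact hd.mul_left _⟩
  refine ⟨fun F hF => ⟨not_isAbelianRigid_of_hasStronglyLinearDivisor hP hF, fun h =>
    key (fun hrp => h (hrp.isAbelianRigid hP hconv)) F hF⟩, fun h => ?_,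
    fun hrp => hrp.isAbelianRigid hP hconv⟩
  by_contra hrp
  obtain ⟨F, hF⟩ := hP.nonempty
  exact not_isAbelianRigid_of_hasStronglyLinearDivisor hP hF (key hrp F hF) h
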